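/- Let $n\ge 2$. Consider $n$ qubits, i.e. the Hilbert space $(\mathbb C^2)^{\otimes n}$, with drift Hamiltonian $$H_0=\sum_{i}\sum_{\alpha\in\{x,y,z\}}\omega^{(i)}_\alpha\,\sigma^{(i)}_\alpha+\sum_{i<j}\ \sum_{\alpha,\beta\in\{x,y,z\}}g^{(i,j)}_{\alpha,\beta}\,\sigma^{(i)}_\alpha\sigma^{(j)}_\beta ,$$ where $\sigma_\alpha^{(i)}$ is the Pauli operator $\sigma_\alpha$ acting on qubit $i$, and $\omega^{(i)}_\alpha,g^{(i,j)}_{\alpha,\beta}$ are arbitrary real numbers. Assume that the graph on the $n$ qubits in which $i<j$ are adjacent iff $g^{(i,j)}_{\alpha,\beta}\neq0$ for some $\alpha,\beta$ is connected, and let $g_{\min}$ be the smallest absolute value of a nonzero coupling constant $g^{(i,j)}_{\alpha,\beta}$. Each qubit has two local controls, so that the evolution is $$\dot U(t)=-i\Big(H_0+\sum_i\big(f^{(i)}_x(t)\,\sigma^{(i)}_x+f^{(i)}_y(t)\,\sigma^{(i)}_y\big)\Big)U(t),\qquad U(0)=\mathbb 1,$$ with freely chosen, unbounded real control fields (continuous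 except at finitely many times, $U$ being continuous throughout). A gate is said to be implementable within time $T$ if, up to a global phase, it is a limit of operators $U(t)$ that can be reached at times $t\le T$ by some choice of the control fields, and $T(U_g)$ denotes the infimum of the times within which $U_g$ is implementable. Let $N_{\mathrm{CNOT}}(U_g)$ be the least number of CNOT gates, between arbitrary pairs of qubits, in a circuit of single-qubit unitaries and CNOT gates that equals $U_g$ up to a global phase. Then, for every $U_g\in \mathrm{SU}(2^n)$, $$T(U_g)\ \le\ \frac{\pi(4n-7)}{4\,g_{\min}}\;N_{\mathrm{CNOT}}(U_g).$$ -/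

import Mathlib

open scoped ENNReal NNReal

noncomputable section

namespace QubitNetwork

/-- Computational basis labels of `n` qubits. -/
abbrev Basis (n : ℕ) : Type := Fin n → Fin 2

/-- Operators on the `2 ^ n`-dimensional space of `n` qubits, as matrices in the computational
basis. -/
abbrev Op (n : ℕ) : Type := Matrix (Basis n) (Basis n) ℂ

/-- The Pauli matrices; the indices `0, 1, 2` stand for `x, y, z`. -/
def pauli : Fin 3 → Matrix (Fin 2) (Fin 2) ℂ :=
  ![!![0, 1; 1, 0], !![0, -Complex.I; Complex.I, 0], !![1, 0; 0, -1]]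

/-- The operator that acts as `A` on qubit `i` and as the identity on every other qubit. -/
def localOp {n : ℕ} (i : Fin n) (A : Matrix (Fin 2) (Fin 2) ℂ) : Op n :=
  Matrix.of fun x y => if ∀ k, k ≠ i → x k = y k then A (x i) (y i) else 0

/-- The spin operator `σ_α` of qubit `i`. -/
def spin {n : ℕ} (i : Fin n) (α : Fin 3) : Op n := localOp i (pauli α)

/-- The drift Hamiltonian with energy splittings `ω i α` and coupling constants `g i j α β`. Each
pair of qubits occurs once, as `i < j`; the values of `g` at the other pairs are not used. -/
def drift {n : ℕ} (ω : Fin n → Fin 3 → ℝ) (g : Fin n → Fin n → Fin 3 → Fin 3 → ℝ) : Op n :=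
  (∑ i, ∑ α, (ω i α : ℂ) • spin i α) +
    ∑ i, ∑ j, if i < j then ∑ α, ∑ β, (g i j α β : ℂ) • (spin i α * spin j β) else 0

/-- The graph of the network: two qubits are adjacent when some coupling constant between them is
nonzero. -/
def couplingGraph {n : ℕ} (g : Fin n → Fin n → Fin 3 → Fin 3 → ℝ) : SimpleGraph (Fin n) :=
  SimpleGraph.fromRel fun i j => i < j ∧ ∃ α β, g i j α β ≠ 0

/-- The smallest absolute value of a nonzero coupling constant. -/
def gMin {n : ℕ} (g : Fin n → Fin n → Fin 3 → Fin 3 → ℝ) : ℝ :=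
  sInf {r : ℝ | ∃ i j α β, i < j ∧ g i j α β ≠ 0 ∧ r = |g i j α β|}

/-- The Hamiltonian at time `t`: drift plus local controls along `σ_x` and `σ_y` on each qubit, with
control fields `fx i` and `fy i`. -/
def hamiltonian {n : ℕ} (ω : Fin n → Fin 3 → ℝ) (g : Fin n → Fin n → Fin 3 → Fin 3 → ℝ)
    (fx fy : Fin n → ℝ → ℝ) (t : ℝ) : Op n :=
  drift ω g + ∑ i, ((fx i t : ℂ) • spin i 0 + (fy i t : ℂ) • spin i 1)

/-- `U` solves `U' = -i H(t) U`, `U 0 = 1` on `[0, T]`, for control fields that are continuous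
outside a finite set of switching times; at the switching times only continuity of `U` is asked. -/
def IsPropagator {n : ℕ} (ω : Fin n → Fin 3 → ℝ) (g : Fin n → Fin n → Fin 3 → Fin 3 → ℝ)
    (fx fy : Fin n → ℝ → ℝ) (T : ℝ) (U : ℝ → Op n) : Prop :=
  U 0 = 1 ∧ ContinuousOn U (Set.Icc 0 T) ∧
    ∃ S : Set ℝ, S.Finite ∧ ∀ t ∈ Set.Ioo 0 T \ S,
      (∀ i, ContinuousAt (fx i) t ∧ ContinuousAt (fy i) t) ∧
      HasDerivAt U (-Complex.I • (hamiltonian ω g fx fy t * U t)) t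

/-- The operators that are reached at some time in `[0, T]`, by some choice of the (unbounded)
control fields. -/
def reachable {n : ℕ} (ω : Fin n → Fin 3 → ℝ) (g : Fin n → Fin n → Fin 3 → Fin 3 → ℝ)
    (T : ℝ) : Set (Op n) :=
  {V | ∃ (t : ℝ) (fx fy : Fin n → ℝ → ℝ) (U : ℝ → Op n),
    0 ≤ t ∧ t ≤ T ∧ IsPropagator ω g fx fy t U ∧ U t = V}

/-- The gate `V` can be implemented within time `T`: up to a global phase it is a limit of operators
that are reachable within time `T`. -/
def ImplementableWithin {n : ℕ} (ω : Fin n → Fin 3 → ℝ)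
    (g : Fin n → Fin n → Fin 3 → Fin 3 → ℝ) (T : ℝ) (V : Op n) : Prop :=
  ∃ φ : ℝ, Complex.exp (φ * Complex.I) • V ∈ closure (reachable ω g T)

/-- The time needed to implement `V`: the infimum of the times within which `V` can be implemented
(`∞` if there is none). -/
def gateTime {n : ℕ} (ω : Fin n → Fin 3 → ℝ) (g : Fin n → Fin n → Fin 3 → Fin 3 → ℝ)
    (V : Op n) : ℝ≥0∞ :=
  ⨅ (T : ℝ≥0) (_ : ImplementableWithin ω g T V), (T : ℝ≥0∞)

/-- The CNOT gate with control `i` and target `j`: it sends the basis vector `y` to the one with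
`y j` replaced by `y j + y i` modulo 2. -/
def cnot {n : ℕ} (i j : Fin n) : Op n :=
  Matrix.of fun x y => if x = Function.update y j (y j + y i) then 1 else 0

/-- `HasCircuit k V`: `V` is a product of single-qubit unitaries, on arbitrary qubits, and exactly
`k` CNOT gates, on arbitrary pairs of distinct qubits. As the single-qubit unitaries include the
scalars of modulus one, this does not depend on the global phase of `V`. -/
inductive HasCircuit {n : ℕ} : ℕ → Op n → Prop
  | one : HasCircuit 0 1
  | single {k : ℕ} {V : Op n} (i : Fin n) (A : Matrix (Fin 2) (Fin 2) ℂ)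
      (hA : A ∈ Matrix.unitaryGroup (Fin 2) ℂ) (hV : HasCircuit k V) :
      HasCircuit k (localOp i A * V)
  | cnot {k : ℕ} {V : Op n} (i j : Fin n) (hij : i ≠ j) (hV : HasCircuit k V) :
      HasCircuit (k + 1) (cnot i j * V)

/-- The least number of CNOT gates in a circuit for `V` (`∞` would mean that there is none). -/
def cnotCount {n : ℕ} (V : Op n) : ℕ∞ :=
  ⨅ (k : ℕ) (_ : HasCircuit k V), (k : ℕ∞)

end QubitNetwork

end

open Filter Topology Pointwise

/-! ### Exponentials and product formulas in Banach algebras. -/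

section BanachAlgebra

variable {A : Type*} [NormedRing A]

/-! Everything is phrased through `achievable ω g T`: these sets are closed, ignore phases, and
multiply with times adding up. Unbounded controls make every single-qubit unitary cost time `0`
(`localOp_mem_achievable`), so only the CNOT gates have to be timed.

Since Pauli operators are free, the drift can be averaged with its conjugate by a Pauli operator, by
the Lie product formula and without slowing down (`twirl_mem_simulable`). Such a twirl deletes the
terms anticommuting with the Pauli operator and keeps the commuting ones at full strength. Suitable
twirls therefore leave one chosen coupling `g i j α β • σ_α σ_β` (`coupling_mem_simulable`). Running
it for time `π / (4 |g i j α β|) ≤ π / (4 gMin g)` gives, up to local gates and a phase, a CNOT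
along that edge.

For distant qubits, conjugation by four CNOTs on an edge moves the control one step along a path
(`cnot_eq_conj`). A path with `d` edges thus costs `4 (d - 1) + 1` edge gates, and `d ≤ n - 1` gives
`4 n - 7`. Multiplying along a circuit with the fewest CNOTs yields the bound. -/

theorem exp_smul_of_mul_self_eq_one [CompleteSpace A] [NormedAlgebra ℂ A] {M : A} (hM : M * M = 1) (θ : ℂ) :
    NormedSpace.exp (θ • (Complex.I • M)) =
      Complex.cos θ • (1 : A) + (Complex.I * Complex.sin θ) • M := by
  let : NormedAlgebra ℚ A := NormedAlgebra.restrictScalars ℚ ℂ A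
  -- The second factor is the inverse of the claimed value, so it suffices that this product is
  -- constant.
  let f : ℂ → A := fun z => NormedSpace.exp (z • (Complex.I • M)) *
    (Complex.cos z • (1 : A) - (Complex.I * Complex.sin z) • M)
  have hf : ∀ z, HasDerivAt f 0 z := by
    intro z
    have h1 := hasDerivAt_exp_smul_const (𝕂 := ℂ) (Complex.I • M) z
    have h2 : HasDerivAt (fun z => Complex.cos z • (1 : A) - (Complex.I * Complex.sin z) • M)
        ((-Complex.sin z) • (1 : A) - (Complex.I * Complex.cos z) • M) z :=
      ((Complex.hasDerivAt_cos z).smul_const 1).sub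
        (((Complex.hasDerivAt_sin z).const_mul Complex.I).smul_const M)
    refine (h1.mul h2).congr_deriv ?_
    rw [mul_assoc, ← mul_add]
    convert mul_zero _
    simp only [mul_sub, mul_one, smul_mul_assoc, mul_smul_comm, hM, smul_smul]
    have : Complex.I * (Complex.I * Complex.sin z) = - Complex.sin z := by
      rw [← mul_assoc, Complex.I_mul_I]; ring
    simp only [this, neg_smul, mul_comm]
    abel
  have hc : f θ = f 0 := is_const_of_deriv_eq_zero (fun z => (hf z).differentiableAt)
    (fun z => (hf z).deriv) θ 0
  have h0 : f 0 = 1 := by simp [f]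
  have hinv : (Complex.cos θ • (1 : A) - (Complex.I * Complex.sin θ) • M) *
      (Complex.cos θ • (1 : A) + (Complex.I * Complex.sin θ) • M) = 1 := by
    simp only [mul_add, sub_mul, smul_mul_assoc, mul_smul_comm, one_mul, mul_one, hM, smul_sub]
    simp only [smul_smul]
    have : Complex.I * Complex.sin θ * (Complex.I * Complex.sin θ) = -(Complex.sin θ ^ 2) := by
      linear_combination Complex.sin θ ^ 2 * Complex.I_mul_I
    rw [this, mul_comm (Complex.cos θ) (Complex.I * _)]
    have h1 : (1 : A) = (Complex.cos θ * Complex.cos θ + Complex.sin θ ^ 2) • (1 : A) := by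
      rw [← pow_two, Complex.cos_sq_add_sin_sq, one_smul]
    conv_rhs => rw [h1]
    simp only [neg_smul, add_smul]
    abel
  calc _ = f θ * (Complex.cos θ • (1 : A) + (Complex.I * Complex.sin θ) • M) := by
        simp only [f]; rw [mul_assoc, hinv, mul_one]
    _ = _ := by rw [hc, h0, one_mul]

/-- Telescoping replaces one factor `x` by `y` at a time. -/
theorem norm_pow_sub_pow_le [NormOneClass A] {x y : A} {M : ℝ} (hM : 1 ≤ M) (hx : ‖x‖ ≤ M)
    (hy : ‖y‖ ≤ M) (n : ℕ) : ‖x ^ n - y ^ n‖ ≤ n * M ^ n * ‖x - y‖ := by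
  induction n with
  | zero => simp
  | succ n ih =>
    have h : x ^ (n + 1) - y ^ (n + 1) = x ^ n * (x - y) + (x ^ n - y ^ n) * y := by
      rw [pow_succ, pow_succ]; noncomm_ring
    have h1 : ‖x ^ n‖ ≤ M ^ n := (norm_pow_le x n).trans (pow_le_pow_left₀ (norm_nonneg _) hx n)
    calc ‖x ^ (n + 1) - y ^ (n + 1)‖ ≤ ‖x ^ n‖ * ‖x - y‖ + ‖x ^ n - y ^ n‖ * ‖y‖ := by
          rw [h]; exact (norm_add_le _ _).trans (add_le_add (norm_mul_le _ _) (norm_mul_le _ _))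
      _ ≤ M ^ n * ‖x - y‖ + (n * M ^ n * ‖x - y‖) * M := by gcongr
      _ ≤ M ^ (n + 1) * ‖x - y‖ + (n * M ^ n * ‖x - y‖) * M := by
          gcongr
          · omega
      _ = _ := by push_cast; ring

/-- Chernoff's product formula. -/
theorem tendsto_pow_exp_of_hasDerivAt [CompleteSpace A] [NormOneClass A] [NormedAlgebra ℝ A] {f : ℝ → A} {X : A}
    (h0 : f 0 = 1) (hf : HasDerivAt f X 0) :
    Tendsto (fun N : ℕ => f (1 / ((N : ℝ) + 1)) ^ (N + 1)) atTop (𝓝 (NormedSpace.exp X)) := by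
  let : NormedAlgebra ℚ A := NormedAlgebra.restrictScalars ℚ ℝ A
  have hs : Tendsto (fun N : ℕ => 1 / ((N : ℝ) + 1)) atTop (𝓝 0) :=
    tendsto_one_div_add_atTop_nhds_zero_nat
  have bound : ∀ h : ℝ → A, h 0 = 1 → HasDerivAt h X 0 →
      ∀ᶠ s in 𝓝 (0 : ℝ), ‖h s‖ ≤ 1 + |s| * (‖X‖ + 1) := by
    intro h h0 hh
    have := hh.isLittleO.bound one_pos
    filter_upwards [this] with s hs
    simp only [sub_zero, h0, one_mul, Real.norm_eq_abs] at hs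
    calc ‖h s‖ = ‖1 + s • X + (h s - 1 - s • X)‖ := by congr 1; abel
      _ ≤ ‖(1 : A)‖ + ‖s • X‖ + |s| := (norm_add₃_le).trans (by gcongr)
      _ = _ := by rw [norm_one, norm_smul, Real.norm_eq_abs]; ring
  have he0 : NormedSpace.exp ((0 : ℝ) • X) = 1 := by simp
  have he : HasDerivAt (fun s : ℝ => NormedSpace.exp (s • X)) X 0 := by
    simpa using hasDerivAt_exp_smul_const (𝕂 := ℝ) X 0
  have hlit : (fun s => f s - NormedSpace.exp (s • X)) =o[𝓝 0] fun s : ℝ => s := by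
    have := (hf.sub he).isLittleO
    simpa [h0] using this
  rw [tendsto_iff_norm_sub_tendsto_zero, Metric.tendsto_atTop]
  intro ε hε
  set C := Real.exp (‖X‖ + 1) with hC
  have hCpos : 0 < C := Real.exp_pos _
  have hev := hs.eventually ((bound f h0 hf).and
    ((bound _ he0 he).and (hlit.bound (show 0 < ε / (2 * C) by positivity))))
  rw [eventually_atTop] at hev
  obtain ⟨N₀, hN₀⟩ := hev
  refine ⟨N₀, fun N hN => ?_⟩
  obtain ⟨h1, h2, h3⟩ := hN₀ N hN
  have hp : (0 : ℝ) < (N : ℝ) + 1 := by positivity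
  set s : ℝ := 1 / ((N : ℝ) + 1) with hsdef
  have hspos : 0 < s := by positivity
  rw [abs_of_pos hspos] at h1 h2
  rw [Real.norm_eq_abs, abs_of_pos hspos] at h3
  have hexp : NormedSpace.exp X = NormedSpace.exp (s • X) ^ (N + 1) := by
    rw [← NormedSpace.exp_nsmul, ← Nat.cast_smul_eq_nsmul ℝ, smul_smul]
    congr 1
    rw [hsdef]; push_cast
    rw [mul_one_div_cancel hp.ne', one_smul]
  -- The `N + 1` one-step errors are each `o(s)` with `s = 1 / (N + 1)`, and the powers of `M` stay
  -- below `exp (‖X‖ + 1)`, so the total error tends to `0`.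
  have hk := norm_pow_sub_pow_le (M := 1 + s * (‖X‖ + 1)) (by
    have := norm_nonneg X; nlinarith) h1 h2 (N + 1)
  have hMn : (1 + s * (‖X‖ + 1)) ^ (N + 1) ≤ C := by
    calc (1 + s * (‖X‖ + 1)) ^ (N + 1) ≤ Real.exp (s * (‖X‖ + 1)) ^ (N + 1) := by
          have := norm_nonneg X
          gcongr
          linarith [Real.add_one_le_exp (s * (‖X‖ + 1))]
      _ = C := by
          rw [← Real.exp_nat_mul, hC]
          congr 1
          push_cast
          rw [← mul_assoc, hsdef, mul_one_div_cancel hp.ne', one_mul]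
  rw [dist_zero_right, Real.norm_eq_abs, abs_of_nonneg (norm_nonneg _), hexp]
  calc _ ≤ _ := hk
    _ ≤ ((N + 1 : ℕ) : ℝ) * C * (ε / (2 * C) * s) := by gcongr
    _ = (((N : ℝ) + 1) * s) * (ε / 2) := by push_cast; field_simp
    _ = ε / 2 := by rw [hsdef, mul_one_div_cancel hp.ne', one_mul]
    _ < ε := by linarith

end BanachAlgebra

/-! ### Reachable and achievable sets: concatenation, limits, phases. -/

namespace QubitNetwork

section Analysis

open scoped Matrix.Norms.Operator

variable {n : ℕ}

theorem continuous_exp_op : Continuous (NormedSpace.exp : Op n → Op n) := by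
  let : NormedAlgebra ℚ (Op n) := NormedAlgebra.restrictScalars ℚ ℂ (Op n)
  exact NormedSpace.exp_continuous

theorem hasDerivAt_exp_smul_op (X : Op n) (t : ℝ) :
    HasDerivAt (fun u : ℝ => NormedSpace.exp (u • X)) (X * NormedSpace.exp (t • X)) t :=
  hasDerivAt_exp_smul_const' (𝕂 := ℝ) X t

theorem hasDerivAt_comp_sub_mul_const_op {U : ℝ → Op n} {U' : Op n} {t r : ℝ}
    (h : HasDerivAt U U' (t - r)) (V : Op n) :
    HasDerivAt (fun s => U (s - r) * V) (U' * V) t :=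
  (HasDerivAt.comp_sub_const t r h).mul_const V

theorem hasDerivAt_congr_op {U V : ℝ → Op n} {U' : Op n} {t : ℝ}
    (h : HasDerivAt U U' t) (hV : V =ᶠ[𝓝 t] U) : HasDerivAt V U' t :=
  HasDerivAt.congr_of_eventuallyEq h hV

theorem exp_smul_I_smul_op {M : Op n} (hM : M * M = 1) (θ : ℂ) :
    NormedSpace.exp (θ • (Complex.I • M)) =
      Complex.cos θ • (1 : Op n) + (Complex.I * Complex.sin θ) • M :=
  exp_smul_of_mul_self_eq_one hM θ

/-- The Lie product formula. -/
theorem tendsto_pow_exp_mul_exp_op (X Y : Op n) :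
    Tendsto (fun N : ℕ => (NormedSpace.exp ((1 / ((N : ℝ) + 1)) • X) *
      NormedSpace.exp ((1 / ((N : ℝ) + 1)) • Y)) ^ (N + 1)) atTop
      (𝓝 (NormedSpace.exp (X + Y))) := by
  refine tendsto_pow_exp_of_hasDerivAt
    (f := fun s : ℝ => NormedSpace.exp (s • X) * NormedSpace.exp (s • Y)) (by simp) ?_
  have hX := hasDerivAt_exp_smul_const' (𝕂 := ℝ) X 0
  have hY := hasDerivAt_exp_smul_const' (𝕂 := ℝ) Y 0
  refine (hX.mul hY).congr_deriv ?_
  simp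

end Analysis

variable {n : ℕ} {ω : Fin n → Fin 3 → ℝ} {g : Fin n → Fin n → Fin 3 → Fin 3 → ℝ}

theorem reachable_mono {s t : ℝ} (h : s ≤ t) : reachable ω g s ⊆ reachable ω g t := by
  rintro V ⟨r, fx, fy, U, h0, hr, hU, rfl⟩
  exact ⟨r, fx, fy, U, h0, hr.trans h, hU, rfl⟩

theorem exp_mem_reachable (a b : Fin n → ℝ) {t : ℝ} (ht : 0 ≤ t) :
    NormedSpace.exp (t • (-Complex.I • (drift ω g +
      ∑ i, ((a i : ℂ) • spin i 0 + (b i : ℂ) • spin i 1)))) ∈ reachable ω g t := by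
  set X := -Complex.I • (drift ω g + ∑ i, ((a i : ℂ) • spin i 0 + (b i : ℂ) • spin i 1))
    with hX
  refine ⟨t, fun i _ => a i, fun i _ => b i, fun s => NormedSpace.exp (s • X), ht, le_rfl,
    ⟨by simp, (continuous_exp_op.comp (by fun_prop)).continuousOn, ∅, Set.finite_empty, ?_⟩, rfl⟩
  intro s _
  refine ⟨fun i => ⟨continuousAt_const, continuousAt_const⟩, ?_⟩
  have := hasDerivAt_exp_smul_op X s
  rw [← smul_mul_assoc]
  exact this

/-- The control fields for `V` are followed by those for `W`, delayed by the first duration `r`. The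
junction `r` joins the switching times, where only continuity of the propagator is needed. -/
theorem mul_mem_reachable {s t : ℝ} {V W : Op n} (hV : V ∈ reachable ω g s)
    (hW : W ∈ reachable ω g t) : W * V ∈ reachable ω g (s + t) := by
  obtain ⟨r, fx, fy, U, hr0, hr, ⟨hU0, hUc, S, hS, hU⟩, rfl⟩ := hV
  obtain ⟨r', fx', fy', U', hr0', hr', ⟨hU0', hUc', S', hS', hU'⟩, rfl⟩ := hW
  refine ⟨r + r', fun i u => if u ≤ r then fx i u else fx' i (u - r),
    fun i u => if u ≤ r then fy i u else fy' i (u - r),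
    fun u => if u ≤ r then U u else U' (u - r) * U r, by positivity, by linarith,
    ⟨by simp [hr0, hU0], ?_, S ∪ (fun u => u + r) '' S' ∪ {r},
      (hS.union (hS'.image _)).union (Set.finite_singleton _), ?_⟩, ?_⟩
  · have h1 : ContinuousOn (fun u => if u ≤ r then U u else U' (u - r) * U r) (Set.Icc 0 r) :=
      hUc.congr fun u hu => if_pos hu.2
    have h2 : ContinuousOn (fun u => if u ≤ r then U u else U' (u - r) * U r)
        (Set.Icc r (r + r')) := by
      have h3 : ContinuousOn (fun u => U' (u - r) * U r) (Set.Icc r (r + r')) := by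
        refine ContinuousOn.mul (hUc'.comp (by fun_prop) ?_) continuousOn_const
        intro u hu
        exact ⟨by linarith [hu.1], by linarith [hu.2]⟩
      refine h3.congr fun u hu => ?_
      rcases hu.1.eq_or_lt with rfl | hlt
      · simp [hU0']
      · exact if_neg (not_le.2 hlt)
    have := h1.union_of_isClosed h2 isClosed_Icc isClosed_Icc
    rwa [Set.Icc_union_Icc_eq_Icc hr0 (by linarith)] at this
  · rintro u ⟨⟨hu0, hu1⟩, huS⟩
    simp only [Set.mem_union, Set.mem_image, Set.mem_singleton_iff, not_or, not_exists,
      not_and] at huS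
    obtain ⟨⟨huS, huS'⟩, hur⟩ := huS
    rcases lt_or_gt_of_ne hur with hlt | hgt
    · obtain ⟨hc, hd⟩ := hU u ⟨⟨hu0, hlt⟩, huS⟩
      have hev : ∀ᶠ v in 𝓝 u, v ≤ r := (eventually_lt_nhds hlt).mono fun v hv => hv.le
      refine ⟨fun i => ⟨(hc i).1.congr (hev.mono fun v hv => (if_pos hv).symm),
        (hc i).2.congr (hev.mono fun v hv => (if_pos hv).symm)⟩, ?_⟩
      convert hasDerivAt_congr_op hd (hev.mono fun v hv => if_pos hv) using 1
      simp [hamiltonian, hlt.le]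
    · have hmem : u - r ∈ Set.Ioo 0 r' \ S' :=
        ⟨⟨by linarith, by linarith⟩, fun h => huS' _ h (by ring)⟩
      obtain ⟨hc, hd⟩ := hU' (u - r) hmem
      have hev : ∀ᶠ v in 𝓝 u, ¬ v ≤ r := (eventually_gt_nhds hgt).mono fun v hv => not_le.2 hv
      have hsub : ContinuousAt (fun v : ℝ => v - r) u := by fun_prop
      refine ⟨fun i => ⟨?_, ?_⟩, ?_⟩
      · exact (ContinuousAt.comp (f := fun v : ℝ => v - r) (hc i).1 hsub).congr
          (hev.mono fun v hv => (if_neg hv).symm)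
      · exact (ContinuousAt.comp (f := fun v : ℝ => v - r) (hc i).2 hsub).congr
          (hev.mono fun v hv => (if_neg hv).symm)
      · have hd' := hasDerivAt_comp_sub_mul_const_op hd (U r)
        convert hasDerivAt_congr_op hd' (hev.mono fun v hv => if_neg hv) using 1
        simp [hamiltonian, hgt.not_ge, mul_assoc]
  · rcases hr0'.eq_or_lt with rfl | hlt
    · simp [hU0']
    · simp [hlt.not_ge]

theorem one_mem_reachable {t : ℝ} (ht : 0 ≤ t) : (1 : Op n) ∈ reachable ω g t := by
  have := exp_mem_reachable (ω := ω) (g := g) 0 0 le_rfl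
  rw [zero_smul, NormedSpace.exp_zero] at this
  exact reachable_mono ht this

/-- Writing the phases as an action of the compact group `Circle` makes closedness a consequence of
compactness. -/
theorem implementableWithin_iff {T : ℝ} {V : Op n} :
    ImplementableWithin ω g T V ↔ V ∈ (Set.univ : Set Circle) • closure (reachable ω g T) := by
  simp only [ImplementableWithin, Set.mem_smul, Set.mem_univ, true_and]
  constructor
  · rintro ⟨φ, h⟩
    refine ⟨(Circle.exp φ)⁻¹, _, h, ?_⟩
    rw [← Circle.coe_exp, ← Circle.smul_def, inv_smul_smul]
  · rintro ⟨c, W, hW, rfl⟩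
    obtain ⟨φ, hφ⟩ := Circle.exp_surjective c⁻¹
    refine ⟨φ, ?_⟩
    rwa [← Circle.coe_exp, ← Circle.smul_def, hφ, inv_smul_smul]

theorem isClosed_setOf_implementableWithin (T : ℝ) :
    IsClosed {V : Op n | ImplementableWithin ω g T V} := by
  simp only [implementableWithin_iff]
  exact isClosed_closure.smul_left_of_isCompact isCompact_univ

/-- The gates whose implementation takes time at most `T`, in the sense of an infimum. -/
def achievable (ω : Fin n → Fin 3 → ℝ) (g : Fin n → Fin n → Fin 3 → Fin 3 → ℝ) (T : ℝ) :
    Set (Op n) :=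
  {V | ∀ T' > T, ImplementableWithin ω g T' V}

theorem isClosed_achievable (T : ℝ) : IsClosed (achievable ω g T) := by
  have : achievable ω g T = ⋂ T' > T, {V : Op n | ImplementableWithin ω g T' V} := by
    ext V; simp [achievable]
  rw [this]
  exact isClosed_biInter fun T' _ => isClosed_setOf_implementableWithin T'

theorem achievable_mono {s t : ℝ} (h : s ≤ t) : achievable ω g s ⊆ achievable ω g t :=
  fun _ hV _ ht => hV _ (h.trans_lt ht)

theorem ImplementableWithin.of_mem_reachable {T : ℝ} {V : Op n} (h : V ∈ reachable ω g T) :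
    ImplementableWithin ω g T V :=
  ⟨0, by simpa using subset_closure h⟩

theorem reachable_subset_achievable (T : ℝ) : reachable ω g T ⊆ achievable ω g T :=
  fun _ hV _ hT => .of_mem_reachable (reachable_mono (le_of_lt hT) hV)

theorem ImplementableWithin.mul {s t : ℝ} {V W : Op n} (hV : ImplementableWithin ω g s V)
    (hW : ImplementableWithin ω g t W) : ImplementableWithin ω g (s + t) (W * V) := by
  obtain ⟨φ, hφ⟩ := hV
  obtain ⟨ψ, hψ⟩ := hW
  refine ⟨ψ + φ, ?_⟩
  have h := map_mem_closure₂ (f := fun A B : Op n => A * B) continuous_mul hψ hφ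
    (u := reachable ω g (s + t)) fun A hA B hB => mul_mem_reachable hB hA
  convert h using 1
  rw [smul_mul_smul_comm, ← Complex.exp_add]
  congr 2
  push_cast
  ring

theorem achievable_mul {s t : ℝ} {V W : Op n} (hW : W ∈ achievable ω g t)
    (hV : V ∈ achievable ω g s) : W * V ∈ achievable ω g (t + s) := by
  intro T' hT'
  have h : 0 < (T' - (t + s)) / 2 := by linarith
  have := (hV (s + (T' - (t + s)) / 2) (by linarith)).mul
    (hW (t + (T' - (t + s)) / 2) (by linarith))
  rwa [show s + (T' - (t + s)) / 2 + (t + (T' - (t + s)) / 2) = T' by ring] at this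

theorem achievable_pow {s : ℝ} {V : Op n} (hV : V ∈ achievable ω g s) (N : ℕ) :
    V ^ N ∈ achievable ω g (N * s) := by
  induction N with
  | zero => simpa using reachable_subset_achievable 0 (one_mem_reachable le_rfl)
  | succ N ih =>
    have := achievable_mul ih hV
    rwa [pow_succ, show ((N + 1 : ℕ) : ℝ) * s = N * s + s by push_cast; ring]

theorem achievable_smul {s : ℝ} {V : Op n} (hV : V ∈ achievable ω g s) {c : ℂ} (hc : ‖c‖ = 1) :
    c • V ∈ achievable ω g s := by
  intro T hT
  have h := hV T hT
  rw [implementableWithin_iff] at h ⊢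
  obtain ⟨d, -, W, hW, rfl⟩ := h
  let c' : Circle := ⟨c, by simpa [Submonoid.unitSphere] using hc⟩
  exact ⟨c' * d, trivial, W, hW, mul_smul c' d W⟩

end QubitNetwork

/-! ### Algebra of local operators and Pauli matrices. -/

namespace QubitNetwork

variable {n : ℕ}

theorem localOp_mul_apply (i : Fin n) (A : Matrix (Fin 2) (Fin 2) ℂ) (M : Op n) (x y : Basis n) :
    (localOp i A * M) x y = ∑ a, A (x i) a * M (Function.update x i a) y := by
  rw [Matrix.mul_apply]
  symm
  refine Fintype.sum_of_injective (fun a => Function.update x i a)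
    (Function.update_injective x i) _ _ (fun z hz => ?_) (fun a => ?_)
  · rw [localOp, Matrix.of_apply, if_neg, zero_mul]
    intro h
    refine hz ⟨z i, funext fun k => ?_⟩
    by_cases hk : k = i
    · subst hk; simp
    · simp [hk, h k hk]
  · rw [localOp, Matrix.of_apply, if_pos fun k hk => by simp [hk]]
    simp

theorem localOp_mul (i : Fin n) (A B : Matrix (Fin 2) (Fin 2) ℂ) :
    localOp i A * localOp i B = localOp i (A * B) := by
  ext x y
  rw [localOp_mul_apply]
  simp only [localOp, Matrix.of_apply, Matrix.mul_apply, Function.update_self]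
  have h : ∀ a, (∀ k, k ≠ i → Function.update x i a k = y k) ↔ ∀ k, k ≠ i → x k = y k :=
    fun a => forall₂_congr fun k hk => by simp [hk]
  simp only [h]
  split_ifs <;> simp

theorem localOp_mul_localOp_apply {i j : Fin n} (hij : i ≠ j) (A B : Matrix (Fin 2) (Fin 2) ℂ)
    (x y : Basis n) : (localOp i A * localOp j B) x y =
      if ∀ k, k ≠ i → k ≠ j → x k = y k then A (x i) (y i) * B (x j) (y j) else 0 := by
  rw [localOp_mul_apply, Finset.sum_eq_single (y i)]
  · simp only [localOp, Matrix.of_apply, Function.update_of_ne hij.symm]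
    have h : (∀ k, k ≠ j → Function.update x i (y i) k = y k) ↔
        ∀ k, k ≠ i → k ≠ j → x k = y k := by
      refine forall_congr' fun k => ?_
      by_cases hk : k = i
      · subst hk; simp
      · simp [hk]
    simp only [h, mul_ite, mul_zero]
  · intro a _ ha
    simp only [localOp, Matrix.of_apply]
    rw [if_neg, mul_zero]
    intro h
    exact ha (by simpa using h i hij)
  · simp

theorem localOp_commute {i j : Fin n} (hij : i ≠ j) (A B : Matrix (Fin 2) (Fin 2) ℂ) :
    Commute (localOp i A) (localOp j B) := by
  ext x y
  rw [localOp_mul_localOp_apply hij, localOp_mul_localOp_apply hij.symm]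
  congr 1
  · exact propext (forall_congr' fun k => ⟨fun h a b => h b a, fun h a b => h b a⟩)
  · ring

theorem localOp_one (i : Fin n) : localOp i (1 : Matrix (Fin 2) (Fin 2) ℂ) = 1 := by
  ext x y
  simp only [localOp, Matrix.of_apply, Matrix.one_apply]
  have : x = y ↔ (∀ k, k ≠ i → x k = y k) ∧ x i = y i :=
    ⟨fun h => by simp [h], fun h => funext fun k => by
      by_cases hk : k = i
      · exact hk ▸ h.2
      · exact h.1 k hk⟩
  simp only [this, ite_and]

theorem localOp_add (i : Fin n) (A B : Matrix (Fin 2) (Fin 2) ℂ) :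
    localOp i (A + B) = localOp i A + localOp i B := by
  ext x y
  simp only [localOp, Matrix.of_apply, Matrix.add_apply]
  split_ifs <;> simp

theorem localOp_smul (i : Fin n) (c : ℂ) (A : Matrix (Fin 2) (Fin 2) ℂ) :
    localOp i (c • A) = c • localOp i A := by
  ext x y
  simp only [localOp, Matrix.of_apply, Matrix.smul_apply]
  split_ifs <;> simp

theorem pauli_mul_self (α : Fin 3) : pauli α * pauli α = 1 := by
  fin_cases α <;> ext a b <;> fin_cases a <;> fin_cases b <;> simp [pauli, Matrix.mul_apply]

theorem pauli_anticommute {α β : Fin 3} (h : α ≠ β) :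
    pauli α * pauli β = -(pauli β * pauli α) := by
  fin_cases α <;> fin_cases β <;>
    first
    | exact absurd rfl h
    | ext a b; fin_cases a <;> fin_cases b <;> simp [pauli, Matrix.mul_apply]

theorem spin_mul_self (i : Fin n) (α : Fin 3) : spin i α * spin i α = 1 := by
  rw [spin, localOp_mul, pauli_mul_self, localOp_one]

theorem pauli_mem_unitaryGroup (α : Fin 3) : pauli α ∈ Matrix.unitaryGroup (Fin 2) ℂ := by
  rw [Matrix.mem_unitaryGroup_iff]
  fin_cases α <;> ext a b <;> fin_cases a <;> fin_cases b <;> simp [pauli, Matrix.mul_apply,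
    Matrix.star_apply]

/-! ### Single-qubit unitaries in zero time. -/

variable {ω : Fin n → Fin 3 → ℝ} {g : Fin n → Fin n → Fin 3 → Fin 3 → ℝ}

/-- An impulse: constant fields `a i / t`, `b i / t` applied for time `t` have a fixed effect, while
the contribution of the drift vanishes as `t → 0`. -/
theorem exp_control_mem_achievable (a b : Fin n → ℝ) :
    NormedSpace.exp (-Complex.I • ∑ i, ((a i : ℂ) • spin i 0 + (b i : ℂ) • spin i 1)) ∈
      achievable ω g 0 := by
  set C : Op n := ∑ i, ((a i : ℂ) • spin i 0 + (b i : ℂ) • spin i 1) with hC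
  intro T hT
  have hlim : Tendsto (fun t : ℝ => NormedSpace.exp (t • (-Complex.I • drift ω g) +
      -Complex.I • C)) (𝓝[>] 0) (𝓝 (NormedSpace.exp (-Complex.I • C))) := by
    have h : Continuous (fun t : ℝ => NormedSpace.exp (t • (-Complex.I • drift ω g) +
      -Complex.I • C)) := continuous_exp_op.comp (by fun_prop)
    have := (h.tendsto 0).mono_left (nhdsWithin_le_nhds (s := Set.Ioi 0))
    simpa using this
  refine (isClosed_setOf_implementableWithin (ω := ω) (g := g) T).mem_of_tendsto hlim ?_
  filter_upwards [Ioo_mem_nhdsGT hT] with t ht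
  refine .of_mem_reachable (reachable_mono ht.2.le ?_)
  convert exp_mem_reachable (fun i => a i / t) (fun i => b i / t) ht.1.le using 2
  have ht0 : (t : ℂ) ≠ 0 := by exact_mod_cast ht.1.ne'
  have hsum : C = (t : ℂ) •
      ∑ i, (((a i / t : ℝ) : ℂ) • spin i 0 + ((b i / t : ℝ) : ℂ) • spin i 1) := by
    rw [hC, Finset.smul_sum]
    refine Finset.sum_congr rfl fun i _ => ?_
    rw [smul_add, smul_smul, smul_smul]
    push_cast
    rw [mul_div_cancel₀ _ ht0, mul_div_cancel₀ _ ht0]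
  rw [smul_add, smul_add, hsum, Complex.coe_smul]
  exact congrArg _ (smul_comm _ _ _)

theorem exp_spin_mem_achievable (i : Fin n) (a b : ℝ) :
    NormedSpace.exp (-Complex.I • localOp i ((a : ℂ) • pauli 0 + (b : ℂ) • pauli 1)) ∈
      achievable ω g 0 := by
  convert exp_control_mem_achievable (Pi.single i a) (Pi.single i b) using 3
  rw [Finset.sum_eq_single i]
  · simp only [localOp_add, localOp_smul, spin, Pi.single_eq_same]
  · intro j _ hj
    simp [hj]
  · simp

theorem exists_norm_one_mul (a : ℂ) : ∃ u : ℂ, ‖u‖ = 1 ∧ a = ‖a‖ * u := by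
  by_cases h0 : a = 0
  · exact ⟨1, by simp, by simp [h0]⟩
  · have : (‖a‖ : ℂ) ≠ 0 := by simpa using h0
    exact ⟨a / ‖a‖, by simp [h0], by field_simp⟩

/-- The rotations about an axis in the `xy`-plane. -/
def planarRotation (w : ℝ) (q : ℂ) : Matrix (Fin 2) (Fin 2) ℂ := !![(w : ℂ), -star q; q, (w : ℂ)]

theorem planarRotation_mem_achievable (i : Fin n) {w : ℝ} {q : ℂ} (h : w ^ 2 + ‖q‖ ^ 2 = 1) :
    localOp i (planarRotation w q) ∈ achievable ω g 0 := by
  obtain ⟨u, hu, hq⟩ := exists_norm_one_mul q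
  obtain ⟨θ, hw, hs⟩ : ∃ θ : ℝ, Real.cos θ = w ∧ Real.sin θ = ‖q‖ := by
    have h1 : ‖(⟨w, ‖q‖⟩ : ℂ)‖ = 1 := by
      rw [Complex.norm_def, Complex.normSq_mk, ← pow_two, ← pow_two, h, Real.sqrt_one]
    have h2 : (⟨w, ‖q‖⟩ : ℂ) ≠ 0 := by
      intro h0; rw [h0] at h1; simp at h1
    refine ⟨Complex.arg ⟨w, ‖q‖⟩, ?_, ?_⟩
    · rw [Complex.cos_arg h2, h1, div_one]
    · rw [Complex.sin_arg, h1, div_one]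
  have hnorm : u.re ^ 2 + u.im ^ 2 = 1 := by
    have := Complex.normSq_eq_norm_sq u
    rw [Complex.normSq_apply, hu] at this
    linarith
  -- The axis is read off the phase `u` of `q`, so that the rotation is `exp (-i θ B)` with `B` an
  -- involution.
  set B : Matrix (Fin 2) (Fin 2) ℂ := ((-u.im : ℝ) : ℂ) • pauli 0 + (u.re : ℂ) • pauli 1 with hB
  have hB2 : localOp i B * localOp i B = 1 := by
    rw [localOp_mul, ← localOp_one i]
    congr 1
    have hn : (u.re : ℂ) ^ 2 + (u.im : ℂ) ^ 2 = 1 := by exact_mod_cast hnorm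
    rw [hB]
    ext a b
    fin_cases a <;> fin_cases b <;> simp [pauli, Matrix.mul_apply] <;>
      linear_combination hn - u.re ^ 2 * Complex.I_mul_I
  have hexp := exp_spin_mem_achievable (ω := ω) (g := g) i (-(θ * u.im)) (θ * u.re)
  have hgen : -Complex.I • localOp i (((-(θ * u.im) : ℝ) : ℂ) • pauli 0 +
      ((θ * u.re : ℝ) : ℂ) • pauli 1) = (-(θ : ℂ)) • (Complex.I • localOp i B) := by
    rw [hB, ← localOp_smul, ← localOp_smul, ← localOp_smul]
    congr 1
    ext a b
    simp
    ring
  rw [hgen, exp_smul_I_smul_op hB2] at hexp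
  convert hexp using 1
  rw [← localOp_one i, ← localOp_smul, ← localOp_smul, ← localOp_add]
  congr 1
  have hu' : u = u.re + u.im * Complex.I := (Complex.re_add_im u).symm
  have hq' : q = Real.sin θ * (u.re + u.im * Complex.I) := by rw [hs, ← hu', ← hq]
  have hsq : star q = Real.sin θ * (u.re - u.im * Complex.I) := by
    rw [hq', Complex.star_def, map_mul, map_add, map_mul, Complex.conj_ofReal, Complex.conj_ofReal,
      Complex.conj_ofReal, Complex.conj_I]
    ring
  rw [planarRotation, hsq, hq', ← hw, hB]
  ext a b
  fin_cases a <;> fin_cases b <;> simp [pauli, -Complex.re_add_im]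
  · linear_combination (Complex.sin θ * u.re) * Complex.I_mul_I
  · linear_combination (Complex.sin θ * u.re) * Complex.I_mul_I

/-- Dividing by a square root `ε` of the determinant puts `A` in `SU(2)`. Such a matrix is a
diagonal `diag(u, star u)` times a planar rotation, and the diagonal is itself a product of two
planar half-turns. -/
theorem localOp_mem_achievable (i : Fin n) {A : Matrix (Fin 2) (Fin 2) ℂ}
    (hA : A ∈ Matrix.unitaryGroup (Fin 2) ℂ) : localOp i A ∈ achievable ω g 0 := by
  have hdet : ‖A.det‖ = 1 := CStarRing.norm_of_mem_unitary (Matrix.det_of_mem_unitary hA)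
  have hAA := Matrix.mem_unitaryGroup_iff.1 hA
  obtain ⟨ε, hε⟩ : ∃ ε : ℂ, ε ^ 2 = A.det := IsAlgClosed.exists_pow_nat_eq _ two_pos
  have hε1 : ‖ε‖ = 1 := by
    have : ‖ε‖ ^ 2 = 1 := by rw [← norm_pow, hε, hdet]
    nlinarith [norm_nonneg ε]
  have hεε : ε * star ε = 1 := by
    rw [Complex.star_def, Complex.mul_conj, Complex.normSq_eq_norm_sq, hε1]; simp
  have hadj : A.adjugate = A.det • star A := by
    have h := congrArg (fun B => A.adjugate * B) hAA
    simp only [← mul_assoc, Matrix.adjugate_mul, mul_one, smul_mul_assoc, one_mul] at h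
    exact h.symm
  rw [Matrix.adjugate_fin_two] at hadj
  have h11 : A 1 1 = ε ^ 2 * star (A 0 0) := by
    simpa [hε, Matrix.star_apply] using congrFun (congrFun hadj 0) 0
  have h10 : A 1 0 = -(ε ^ 2 * star (A 0 1)) := by
    have := congrFun (congrFun hadj 1) 0
    simp [Matrix.star_apply] at this
    rw [hε, ← neg_eq_iff_eq_neg]
    simpa using this
  have hnorm : ‖A 0 0‖ ^ 2 + ‖A 0 1‖ ^ 2 = 1 := by
    have h := congrFun (congrFun hAA 0) 0
    simp only [Matrix.mul_apply, Matrix.star_apply, Fin.sum_univ_two, Matrix.one_apply_eq,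
      Complex.star_def, Complex.mul_conj, Complex.normSq_eq_norm_sq] at h
    exact_mod_cast h
  obtain ⟨u, hu, ha⟩ := exists_norm_one_mul (A 0 0 * star ε)
  have hna : ‖A 0 0 * star ε‖ = ‖A 0 0‖ := by simp [hε1]
  rw [hna] at ha
  have huu : u * star u = 1 := by
    rw [Complex.star_def, Complex.mul_conj, Complex.normSq_eq_norm_sq, hu]; simp
  -- The first two rotations multiply to `diag(u, star u)`; the third has the nonnegative real
  -- diagonal entry `‖A 0 0‖`.
  have h1 := planarRotation_mem_achievable (ω := ω) (g := g) i (w := 0) (q := 1) (by simp)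
  have h2 := planarRotation_mem_achievable (ω := ω) (g := g) i (w := 0) (q := -u) (by simp [hu])
  have h3 := planarRotation_mem_achievable (ω := ω) (g := g) i (w := ‖A 0 0‖)
    (q := -(star (A 0 1) * ε * u)) (by simpa [hu, hε1] using hnorm)
  have h := achievable_smul (achievable_mul (achievable_mul h1 h2) h3) hε1
  rw [localOp_mul, localOp_mul, ← localOp_smul, add_zero, add_zero] at h
  convert h using 2
  have ha' : A 0 0 = ε * u * ‖A 0 0‖ := by
    linear_combination ε * ha - A 0 0 * hεε
  have ha'' : star (A 0 0) = star ε * star u * ‖A 0 0‖ := by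
    conv_lhs => rw [ha']
    simp
  rw [ha''] at h11
  ext a b
  fin_cases a <;> fin_cases b <;> simp [planarRotation] <;>
    simp only [Complex.star_def] at *
  · linear_combination ha'
  · linear_combination (-A 0 1) * hεε - A 0 1 * ε * (starRingEnd ℂ) ε * huu
  · linear_combination h10 + ε ^ 2 * (starRingEnd ℂ) (A 0 1) * huu
  · linear_combination h11 + ε * (starRingEnd ℂ) u * ‖A 0 0‖ * hεε

end QubitNetwork

/-! ### Decoupling by Pauli twirls. -/

namespace QubitNetwork

variable {n : ℕ} {ω : Fin n → Fin 3 → ℝ} {g : Fin n → Fin n → Fin 3 → Fin 3 → ℝ}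

/-- The Hamiltonians whose evolution can be simulated in real time. -/
def simulable (ω : Fin n → Fin 3 → ℝ) (g : Fin n → Fin n → Fin 3 → Fin 3 → ℝ) : Set (Op n) :=
  {H | ∀ t : ℝ, 0 ≤ t → NormedSpace.exp (t • (-Complex.I • H)) ∈ achievable ω g t}

theorem drift_mem_simulable : drift ω g ∈ simulable ω g := by
  intro t ht
  simpa using reachable_subset_achievable t (exp_mem_reachable (ω := ω) (g := g) 0 0 ht)

theorem conj_mem_simulable {P H : Op n} (hP : P * P = 1) (hPa : P ∈ achievable ω g 0)
    (hH : H ∈ simulable ω g) : P * H * P ∈ simulable ω g := by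
  intro t ht
  have hinv : P⁻¹ = P := Matrix.inv_eq_right_inv hP
  have h := Matrix.exp_conj P (t • (-Complex.I • H)) ⟨⟨P, P, hP, hP⟩, rfl⟩
  rw [hinv, mul_smul_comm, smul_mul_assoc, mul_smul_comm, smul_mul_assoc] at h
  rw [h]
  simpa using achievable_mul (achievable_mul hPa (hH t ht)) hPa

/-- Alternating `H` and `K` in short slices, each for half of the total time, converges to the
evolution under the mean by the Lie product formula. -/
theorem average_mem_simulable {H K : Op n} (hH : H ∈ simulable ω g) (hK : K ∈ simulable ω g) :
    (1 / 2 : ℂ) • (H + K) ∈ simulable ω g := by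
  intro t ht
  have hlim := tendsto_pow_exp_mul_exp_op ((t / 2) • (-Complex.I • H)) ((t / 2) • (-Complex.I • K))
  have hsum : (t / 2) • (-Complex.I • H) + (t / 2) • (-Complex.I • K) =
      t • (-Complex.I • ((1 / 2 : ℂ) • (H + K))) := by
    simp only [← Complex.coe_smul, smul_smul, ← smul_add]
    congr 1
    push_cast
    ring
  rw [hsum] at hlim
  refine (isClosed_achievable t).mem_of_tendsto hlim (Eventually.of_forall fun N => ?_)
  have hp : (0 : ℝ) < (N : ℝ) + 1 := by positivity
  have h1 : 0 ≤ 1 / ((N : ℝ) + 1) * (t / 2) := by positivity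
  have h := achievable_pow (achievable_mul (hH _ h1) (hK _ h1)) (N + 1)
  rw [smul_smul, smul_smul]
  convert h using 1
  push_cast
  field_simp
  ring_nf

/-- The average of an operator and its conjugate by the involution `P`. -/
noncomputable def twirl (P : Op n) : Op n →ₗ[ℂ] Op n :=
  (1 / 2 : ℂ) • (LinearMap.id + LinearMap.mulLeft ℂ P ∘ₗ LinearMap.mulRight ℂ P)

theorem twirl_apply (P X : Op n) : twirl P X = (1 / 2 : ℂ) • (X + P * X * P) := by
  simp [twirl, mul_assoc]

theorem twirl_mem_simulable {P H : Op n} (hP : P * P = 1) (hPa : P ∈ achievable ω g 0)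
    (hH : H ∈ simulable ω g) : twirl P H ∈ simulable ω g := by
  rw [twirl_apply]
  exact average_mem_simulable hH (conj_mem_simulable hP hPa hH)

theorem twirl_of_conj_eq_smul {P X : Op n} {s : ℝ} (h : P * X * P = (s : ℂ) • X) :
    twirl P X = (((1 + s) / 2 : ℝ) : ℂ) • X := by
  rw [twirl_apply, h]
  push_cast
  module

theorem conj_mul {P : Op n} (hP : P * P = 1) (X Y : Op n) :
    P * (X * Y) * P = (P * X * P) * (P * Y * P) := by
  calc P * (X * Y) * P = P * X * (P * P) * Y * P := by rw [hP]; noncomm_ring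
    _ = _ := by noncomm_ring

theorem conj_mul_eq_smul {P X Y : Op n} {r s : ℂ} (hP : P * P = 1) (hX : P * X * P = r • X)
    (hY : P * Y * P = s • Y) : P * (X * Y) * P = (r * s) • (X * Y) := by
  rw [conj_mul hP, hX, hY, smul_mul_smul_comm]

/-- `1` if `σ_γ` on qubit `k` commutes with `σ_α` on qubit `i`, and `0` otherwise. -/
noncomputable def mask (k : Fin n) (γ : Fin 3) (i : Fin n) (α : Fin 3) : ℝ := if i = k ∧ α ≠ γ then 0 else 1

theorem spin_commute {i j : Fin n} (hij : i ≠ j) (α β : Fin 3) :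
    Commute (spin i α) (spin j β) := localOp_commute hij _ _

theorem spin_anticommute (i : Fin n) {α β : Fin 3} (h : α ≠ β) :
    spin i α * spin i β = -(spin i β * spin i α) := by
  rw [spin, spin, localOp_mul, localOp_mul, pauli_anticommute h, ← neg_one_smul ℂ, localOp_smul,
    neg_one_smul]

theorem spin_conj_of_ne {i k : Fin n} (h : k ≠ i) (α γ : Fin 3) :
    spin k γ * spin i α * spin k γ = spin i α := by
  rw [(spin_commute h γ α).eq, mul_assoc, spin_mul_self, mul_one]

theorem spin_conj_of_index_ne (i : Fin n) {α γ : Fin 3} (h : γ ≠ α) :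
    spin i γ * spin i α * spin i γ = -spin i α := by
  rw [spin_anticommute i h, neg_mul, mul_assoc, spin_mul_self, mul_one]

theorem spin_conj_self (i : Fin n) (α : Fin 3) :
    spin i α * spin i α * spin i α = spin i α := by
  rw [spin_mul_self, one_mul]

theorem spin_conj (k i : Fin n) (γ α : Fin 3) :
    spin k γ * spin i α * spin k γ = ((2 * mask k γ i α - 1 : ℝ) : ℂ) • spin i α := by
  by_cases hk : i = k
  · subst hk
    by_cases ha : α = γ
    · subst ha
      rw [spin_conj_self]
      norm_num [mask]
    · rw [spin_conj_of_index_ne i (Ne.symm ha)]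
      simp [mask, ha]
  · rw [spin_conj_of_ne (Ne.symm hk)]
    norm_num [mask, hk]

theorem twirl_spin (k i : Fin n) (γ α : Fin 3) :
    twirl (spin k γ) (spin i α) = (mask k γ i α : ℂ) • spin i α := by
  rw [twirl_of_conj_eq_smul (spin_conj k i γ α)]
  congr 2
  ring

/-- The factor is `(1 + (2a - 1)(2b - 1)) / 2` for the two masks `a`, `b`. It equals `a * b` because
`k` meets at most one of the distinct qubits `i`, `j`, so one mask is `1`. -/
theorem twirl_spin_mul_spin (k : Fin n) (γ : Fin 3) {i j : Fin n} (hij : i ≠ j) (α β : Fin 3) :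
    twirl (spin k γ) (spin i α * spin j β) =
      ((mask k γ i α * mask k γ j β : ℝ) : ℂ) • (spin i α * spin j β) := by
  have h := conj_mul_eq_smul (spin_mul_self k γ) (spin_conj k i γ α) (spin_conj k j γ β)
  rw [← Complex.ofReal_mul] at h
  rw [twirl_of_conj_eq_smul h]
  congr 2
  have hone : mask k γ i α = 1 ∨ mask k γ j β = 1 := by
    by_cases hi : i = k
    · right; simp [mask, show j ≠ k from fun hj => hij (hi.trans hj.symm)]
    · left; simp [mask, hi]
  rcases hone with h | h <;> rw [h] <;> ring

theorem twirl_spin_drift (k : Fin n) (γ : Fin 3) (ω : Fin n → Fin 3 → ℝ)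
    (g : Fin n → Fin n → Fin 3 → Fin 3 → ℝ) :
    twirl (spin k γ) (drift ω g) = drift (fun i α => mask k γ i α * ω i α)
      (fun i j α β => mask k γ i α * mask k γ j β * g i j α β) := by
  simp only [drift, map_add, map_sum, map_smul, twirl_spin, smul_smul]
  congr 1
  · refine Finset.sum_congr rfl fun i _ => Finset.sum_congr rfl fun α _ => ?_
    push_cast
    rw [mul_comm]
  · refine Finset.sum_congr rfl fun i _ => Finset.sum_congr rfl fun j _ => ?_
    split_ifs with hij
    · simp only [map_sum, map_smul]
      refine Finset.sum_congr rfl fun α _ => Finset.sum_congr rfl fun β _ => ?_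
      rw [twirl_spin_mul_spin k γ hij.ne, smul_smul]
      push_cast
      rw [mul_comm]
    · exact map_zero _

theorem spin_mem_achievable (i : Fin n) (α : Fin 3) : spin i α ∈ achievable ω g 0 :=
  localOp_mem_achievable i (pauli_mem_unitaryGroup α)

theorem masked_drift_mem_simulable (S : Finset (Fin n × Fin 3)) :
    drift (fun i α => (∏ p ∈ S, mask p.1 p.2 i α) * ω i α)
      (fun i j α β => (∏ p ∈ S, mask p.1 p.2 i α) * (∏ p ∈ S, mask p.1 p.2 j β) * g i j α β) ∈
      simulable ω g := by
  induction S using Finset.induction_on with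
  | empty => simpa using drift_mem_simulable
  | insert p S hp ih =>
    have h := twirl_mem_simulable (spin_mul_self p.1 p.2) (spin_mem_achievable p.1 p.2) ih
    rw [twirl_spin_drift] at h
    simp only [Finset.prod_insert hp]
    convert h using 1
    congr 1
    · funext i α
      ring
    · funext i j α β
      ring

theorem spin_mul_spin_mul_self {i j : Fin n} (hij : i ≠ j) (α β : Fin 3) :
    spin i α * spin j β * (spin i α * spin j β) = 1 := by
  rw [mul_assoc, ← mul_assoc (spin j β), ← (spin_commute hij α β).eq, mul_assoc (spin i α),
    spin_mul_self, mul_one, spin_mul_self]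

theorem spin_mul_spin_mem_achievable (i j : Fin n) (α β : Fin 3) :
    spin i α * spin j β ∈ achievable ω g 0 := by
  simpa using achievable_mul (ω := ω) (g := g) (spin_mem_achievable i α) (spin_mem_achievable j β)

/-- Decoupling isolates any single coupling term. -/
theorem coupling_mem_simulable {i j : Fin n} (hij : i < j) (α β : Fin 3) :
    (g i j α β : ℂ) • (spin i α * spin j β) ∈ simulable ω g := by
  classical
  -- Twirling by `σ_α` on `i`, by `σ_β` on `j`, and by all three Pauli operators on each other qubit
  -- leaves only the chosen coupling and the local terms `σ_α` on `i` and `σ_β` on `j`.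
  let S : Finset (Fin n × Fin 3) :=
    Finset.univ.filter fun p => (p.1 = i → p.2 = α) ∧ (p.1 = j → p.2 = β)
  let M : Fin n → Fin 3 → ℝ := fun k γ => ∏ p ∈ S, mask p.1 p.2 k γ
  have hMone : ∀ k γ, (k = i ∧ γ = α) ∨ (k = j ∧ γ = β) → M k γ = 1 := by
    intro k γ h
    refine Finset.prod_eq_one fun p hp => if_neg ?_
    rintro ⟨h1, h2⟩
    have hp' := (Finset.mem_filter.1 hp).2
    rcases h with ⟨rfl, rfl⟩ | ⟨rfl, rfl⟩
    · exact h2 (hp'.1 h1.symm).symm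
    · exact h2 (hp'.2 h1.symm).symm
  have hMzero : ∀ k γ, ¬ ((k = i ∧ γ = α) ∨ (k = j ∧ γ = β)) → M k γ = 0 := by
    intro k γ h
    rw [not_or, not_and, not_and] at h
    by_cases hki : k = i
    · subst hki
      refine Finset.prod_eq_zero (i := (k, α)) ?_ (if_pos ⟨rfl, h.1 rfl⟩)
      simp [S, hij.ne]
    by_cases hkj : k = j
    · subst hkj
      refine Finset.prod_eq_zero (i := (k, β)) ?_ (if_pos ⟨rfl, h.2 rfl⟩)
      simp [S, hij.ne']
    · obtain ⟨δ, hδ⟩ := exists_ne γ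
      refine Finset.prod_eq_zero (i := (k, δ)) ?_ (if_pos ⟨rfl, hδ.symm⟩)
      simp [S, hki, hkj]
  -- A last twirl by `σ_α' σ_β'` removes the two surviving local terms, which anticommute with it;
  -- their product picks up two signs and is kept.
  obtain ⟨α', hα⟩ := exists_ne α
  obtain ⟨β', hβ⟩ := exists_ne β
  have hP := spin_mul_spin_mul_self hij.ne α' β'
  have hi : spin i α' * spin j β' * spin i α * (spin i α' * spin j β') =
      ((-1 : ℝ) : ℂ) • spin i α := by
    calc _ = spin i α' * (spin j β' * spin i α * spin j β') * spin i α' := by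
          rw [(spin_commute hij.ne α' β').eq]; nth_rw 1 [← (spin_commute hij.ne α' β').eq]
          noncomm_ring
      _ = _ := by rw [spin_conj_of_ne hij.ne', spin_conj_of_index_ne i hα]; simp
  have hj : spin i α' * spin j β' * spin j β * (spin i α' * spin j β') =
      ((-1 : ℝ) : ℂ) • spin j β := by
    calc _ = spin i α' * (spin j β' * spin j β * spin j β') * spin i α' := by
          nth_rw 2 [(spin_commute hij.ne α' β').eq]
          noncomm_ring
      _ = _ := by rw [spin_conj_of_index_ne j hβ, mul_neg, neg_mul, spin_conj_of_ne hij.ne]; simp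
  have hcpl : twirl (spin i α' * spin j β') (spin i α * spin j β) = spin i α * spin j β := by
    have h := conj_mul_eq_smul hP hi hj
    rw [← Complex.ofReal_mul] at h
    rw [twirl_of_conj_eq_smul h]
    norm_num
  have h := twirl_mem_simulable hP (spin_mul_spin_mem_achievable i j α' β')
    (masked_drift_mem_simulable (ω := ω) (g := g) S)
  convert h using 1
  change _ = twirl _ (drift (fun k γ => M k γ * ω k γ) (fun k l γ δ => M k γ * M l δ * g k l γ δ))
  rw [drift, map_add]
  have hlocal : twirl (spin i α' * spin j β')
      (∑ k, ∑ γ, ((M k γ * ω k γ : ℝ) : ℂ) • spin k γ) = 0 := by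
    rw [map_sum]
    refine Finset.sum_eq_zero fun k _ => ?_
    rw [map_sum]
    refine Finset.sum_eq_zero fun γ _ => ?_
    rw [map_smul]
    by_cases h : (k = i ∧ γ = α) ∨ (k = j ∧ γ = β)
    · rcases h with ⟨rfl, rfl⟩ | ⟨rfl, rfl⟩
      · rw [twirl_of_conj_eq_smul hi]; simp
      · rw [twirl_of_conj_eq_smul hj]; simp
    · rw [hMzero k γ h]; simp
  have hcoupling : (∑ k, ∑ l, if k < l then
      ∑ γ, ∑ δ, ((M k γ * M l δ * g k l γ δ : ℝ) : ℂ) • (spin k γ * spin l δ) else 0) =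
      (g i j α β : ℂ) • (spin i α * spin j β) := by
    have hzero : ∀ k l γ δ, k < l → ¬ (k = i ∧ l = j ∧ γ = α ∧ δ = β) →
        ((M k γ * M l δ * g k l γ δ : ℝ) : ℂ) • (spin k γ * spin l δ) = 0 := by
      intro k l γ δ hkl h
      by_cases h1 : (k = i ∧ γ = α) ∨ (k = j ∧ γ = β)
      · by_cases h2 : (l = i ∧ δ = α) ∨ (l = j ∧ δ = β)
        · exfalso
          rcases h1 with ⟨rfl, rfl⟩ | ⟨rfl, rfl⟩ <;> rcases h2 with ⟨rfl, rfl⟩ | ⟨rfl, rfl⟩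
          · exact lt_irrefl _ hkl
          · exact h ⟨rfl, rfl, rfl, rfl⟩
          · exact lt_asymm hkl hij
          · exact lt_irrefl _ hkl
        · rw [hMzero l δ h2]; simp
      · rw [hMzero k γ h1]; simp
    rw [Finset.sum_eq_single i, Finset.sum_eq_single j, if_pos hij, Finset.sum_eq_single α,
      Finset.sum_eq_single β, hMone i α (.inl ⟨rfl, rfl⟩), hMone j β (.inr ⟨rfl, rfl⟩)]
    · simp
    · exact fun δ _ hδ => hzero _ _ _ _ hij fun h => hδ h.2.2.2
    · simp
    · exact fun γ _ hγ => Finset.sum_eq_zero fun δ _ => hzero _ _ _ _ hij fun h => hγ h.2.2.1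
    · simp
    · intro l _ hl
      split_ifs with hlt
      · exact Finset.sum_eq_zero fun γ _ => Finset.sum_eq_zero fun δ _ =>
          hzero _ _ _ _ hlt fun h => hl h.2.1
      · rfl
    · simp
    · intro k _ hk
      refine Finset.sum_eq_zero fun l _ => ?_
      split_ifs with hlt
      · exact Finset.sum_eq_zero fun γ _ => Finset.sum_eq_zero fun δ _ =>
          hzero _ _ _ _ hlt fun h => hk h.1
      · rfl
    · simp
  rw [hlocal, hcoupling, map_smul, hcpl, zero_add]

end QubitNetwork

/-! ### CNOT gates along the edges of the network. -/

namespace QubitNetwork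

variable {n : ℕ} {ω : Fin n → Fin 3 → ℝ} {g : Fin n → Fin n → Fin 3 → Fin 3 → ℝ}

theorem finite_setOf_coupling (g : Fin n → Fin n → Fin 3 → Fin 3 → ℝ) :
    {r : ℝ | ∃ i j α β, i < j ∧ g i j α β ≠ 0 ∧ r = |g i j α β|}.Finite := by
  refine (Set.finite_range fun p : Fin n × Fin n × Fin 3 × Fin 3 =>
    |g p.1 p.2.1 p.2.2.1 p.2.2.2|).subset ?_
  rintro r ⟨i, j, α, β, -, -, rfl⟩
  exact ⟨(i, j, α, β), rfl⟩

theorem gMin_le {i j : Fin n} {α β : Fin 3} (hij : i < j) (h : g i j α β ≠ 0) :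
    gMin g ≤ |g i j α β| :=
  csInf_le (finite_setOf_coupling g).bddBelow ⟨i, j, α, β, hij, h, rfl⟩

theorem gMin_pos {i j : Fin n} {α β : Fin 3} (hij : i < j) (h : g i j α β ≠ 0) : 0 < gMin g := by
  obtain ⟨i, j, α, β, -, h, h'⟩ := Set.Nonempty.csInf_mem
    (s := {r : ℝ | ∃ i j α β, i < j ∧ g i j α β ≠ 0 ∧ r = |g i j α β|})
    ⟨_, i, j, α, β, hij, h, rfl⟩ (finite_setOf_coupling g)
  rw [gMin, h']
  exact abs_pos.2 h

/-- The time of one entangling gate along an edge of the network. -/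
noncomputable def edgeTime (g : Fin n → Fin n → Fin 3 → Fin 3 → ℝ) : ℝ := Real.pi / (4 * gMin g)

theorem entangler_mem_achievable {i j : Fin n} {α β : Fin 3} (hij : i < j) (h : g i j α β ≠ 0) :
    ((√2 / 2 : ℝ) : ℂ) • (1 + Complex.I • (spin i α * spin j β)) ∈
      achievable ω g (edgeTime g) := by
  set M : Op n := spin i α * spin j β with hM
  have hMM : M * M = 1 := spin_mul_spin_mul_self hij.ne α β
  have habs : 0 < |g i j α β| := abs_pos.2 h
  have ht : Real.pi / (4 * |g i j α β|) ≤ edgeTime g := by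
    have h1 := gMin_pos hij h
    have h2 := gMin_le hij h
    have := Real.pi_pos
    rw [edgeTime]
    gcongr
  have hexp := achievable_mono ht (coupling_mem_simulable (ω := ω) (g := g) hij α β
    (Real.pi / (4 * |g i j α β|)) (by positivity))
  rcases lt_or_gt_of_ne h with hneg | hpos
  · have hgen : (Real.pi / (4 * |g i j α β|)) • (-Complex.I • ((g i j α β : ℂ) • M)) =
        ((Real.pi / 4 : ℝ) : ℂ) • (Complex.I • M) := by
      rw [abs_of_neg hneg, ← Complex.coe_smul, smul_smul, smul_smul, smul_smul]
      congr 1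
      have : (g i j α β : ℂ) ≠ 0 := by exact_mod_cast h
      push_cast
      field_simp
    rw [hgen, exp_smul_I_smul_op hMM, ← Complex.ofReal_cos, ← Complex.ofReal_sin,
      Real.cos_pi_div_four, Real.sin_pi_div_four] at hexp
    convert hexp using 1
    module
  · have hgen : (Real.pi / (4 * |g i j α β|)) • (-Complex.I • ((g i j α β : ℂ) • M)) =
        ((-(Real.pi / 4) : ℝ) : ℂ) • (Complex.I • M) := by
      rw [abs_of_pos hpos, ← Complex.coe_smul, smul_smul, smul_smul, smul_smul]
      congr 1
      have : (g i j α β : ℂ) ≠ 0 := by exact_mod_cast h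
      push_cast
      field_simp
    rw [hgen, exp_smul_I_smul_op hMM, ← Complex.ofReal_cos, ← Complex.ofReal_sin,
      Real.cos_neg, Real.sin_neg, Real.cos_pi_div_four, Real.sin_pi_div_four] at hexp
    -- For positive coupling the evolution has the opposite sign; the free factor `i M` corrects it,
    -- since `i M (1 - i M) = 1 + i M`.
    have h2 := achievable_smul (achievable_mul (spin_mul_spin_mem_achievable i j α β) hexp)
      (c := Complex.I) (by simp)
    rw [zero_add, ← hM] at h2
    convert h2 using 1
    have hI : Complex.I * (Complex.I * ((-(√2 / 2) : ℝ) : ℂ)) = ((√2 / 2 : ℝ) : ℂ) := by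
      push_cast
      linear_combination (-(√2 : ℂ) / 2) * Complex.I_mul_I
    simp only [smul_add, smul_smul, mul_add, mul_smul_comm, hMM, mul_one, hI]
    module

/-- For distinct indices this is the Hadamard-type involution `(σ_α + σ_γ) / √2`, the half-turn
about the bisector of the two axes. -/
theorem exists_pauli_conj (α γ : Fin 3) :
    ∃ A ∈ Matrix.unitaryGroup (Fin 2) ℂ, A * A = 1 ∧ A * pauli α * A = pauli γ := by
  by_cases h : α = γ
  · exact ⟨1, one_mem _, by simp, by simp [h]⟩
  have hs : ((√2 / 2 : ℝ) : ℂ) * ((√2 / 2 : ℝ) : ℂ) = 1 / 2 := by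
    rw [← Complex.ofReal_mul]
    norm_num [div_mul_div_comm]
  set c : ℂ := ((√2 / 2 : ℝ) : ℂ) with hc
  have hanti := pauli_anticommute h
  have hstar : ∀ δ, star (pauli δ) = pauli δ := by
    intro δ
    fin_cases δ <;> ext a b <;> fin_cases a <;> fin_cases b <;> simp [pauli, Matrix.star_apply]
  have hsq : (c • (pauli α + pauli γ)) * (c • (pauli α + pauli γ)) = 1 := by
    rw [smul_mul_smul_comm, hs, mul_add, add_mul, add_mul, pauli_mul_self, pauli_mul_self, hanti]
    module
  refine ⟨c • (pauli α + pauli γ), ?_, hsq, ?_⟩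
  · rw [Matrix.mem_unitaryGroup_iff, star_smul, star_add, hstar, hstar]
    have : star c = c := by rw [hc, Complex.star_def, Complex.conj_ofReal]
    rw [this, hsq]
  · have e : pauli γ * pauli α * pauli γ = -pauli α := by
      rw [mul_assoc, hanti, mul_neg, ← mul_assoc, pauli_mul_self, one_mul]
    rw [smul_mul_assoc, smul_mul_assoc, mul_smul_comm, smul_smul, hs, add_mul, pauli_mul_self,
      add_mul, one_mul, mul_add, mul_assoc (pauli γ) (pauli α) (pauli α), pauli_mul_self, mul_one, e]
    module

theorem entangler_conj_mem_achievable {i j : Fin n} (hij : i ≠ j) {T : ℝ} {α β : Fin 3}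
    (h : ((√2 / 2 : ℝ) : ℂ) • (1 + Complex.I • (spin i α * spin j β)) ∈ achievable ω g T)
    (γ δ : Fin 3) :
    ((√2 / 2 : ℝ) : ℂ) • (1 + Complex.I • (spin i γ * spin j δ)) ∈ achievable ω g T := by
  obtain ⟨A, hA, hAA, hAc⟩ := exists_pauli_conj α γ
  obtain ⟨B, hB, hBB, hBc⟩ := exists_pauli_conj β δ
  have hP : localOp i A * localOp i A = 1 := by rw [localOp_mul, hAA, localOp_one]
  have hQ : localOp j B * localOp j B = 1 := by rw [localOp_mul, hBB, localOp_one]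
  have hPX : localOp i A * spin i α * localOp i A = spin i γ := by
    rw [spin, localOp_mul, localOp_mul, hAc, spin]
  have hQY : localOp j B * spin j β * localOp j B = spin j δ := by
    rw [spin, localOp_mul, localOp_mul, hBc, spin]
  have hQX : localOp j B * spin i α * localOp j B = spin i α := by
    rw [spin, ← (localOp_commute hij (pauli α) B).eq, mul_assoc, hQ, mul_one]
  have hPY : localOp i A * spin j δ * localOp i A = spin j δ := by
    rw [spin, (localOp_commute hij A (pauli δ)).eq, mul_assoc, hP, mul_one]
  have hPa := localOp_mem_achievable (ω := ω) (g := g) i hA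
  have hQa := localOp_mem_achievable (ω := ω) (g := g) j hB
  have hconj : ∀ {R X : Op n} (c : ℂ), R * R = 1 → R * (c • (1 + Complex.I • X)) * R =
      c • (1 + Complex.I • (R * X * R)) := by
    intro R X c hR
    rw [mul_smul_comm, smul_mul_assoc, mul_add, add_mul, mul_one, hR, mul_smul_comm,
      smul_mul_assoc]
  have h1 := achievable_mul (achievable_mul hPa (achievable_mul (achievable_mul hQa h) hQa)) hPa
  rw [hconj _ hQ, hconj _ hP, conj_mul hQ, hQX, hQY, conj_mul hP, hPX, hPY] at h1
  simpa only [zero_add, add_zero] using h1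

theorem cnot_eq {i j : Fin n} (hij : i ≠ j) :
    cnot i j = (1 / 2 : ℂ) • (1 + spin i 2 + spin j 0 - spin i 2 * spin j 0) := by
  have h1 : (1 : Op n) = localOp i 1 * localOp j 1 := by simp [localOp_one]
  have h2 : (spin i 2 : Op n) = localOp i (pauli 2) * localOp j 1 := by simp [localOp_one, spin]
  have h3 : (spin j 0 : Op n) = localOp i 1 * localOp j (pauli 0) := by simp [localOp_one, spin]
  have h4 : (spin i 2 * spin j 0 : Op n) = localOp i (pauli 2) * localOp j (pauli 0) := rfl
  rw [h4, h1, h2, h3]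
  ext x y
  simp only [Matrix.smul_apply, Matrix.sub_apply, Matrix.add_apply,
    localOp_mul_localOp_apply hij, cnot, Matrix.of_apply]
  have hiff : x = Function.update y j (y j + y i) ↔
      (∀ k, k ≠ i → k ≠ j → x k = y k) ∧ x i = y i ∧ x j = y j + y i := by
    constructor
    · rintro rfl
      exact ⟨fun k _ hk => by simp [hk], by simp [hij], by simp⟩
    · rintro ⟨h, hi, hj⟩
      funext k
      by_cases hkj : k = j
      · subst hkj; simp [hj]
      · by_cases hki : k = i
        · subst hki; simp [hkj, hi]
        · simp [hkj, h k hki hkj]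
  simp only [hiff]
  by_cases h : ∀ k, k ≠ i → k ≠ j → x k = y k
  · have hp0 : pauli 0 = !![0, 1; 1, 0] := rfl
    have hp2 : pauli 2 = !![1, 0; 0, -1] := rfl
    have h11 : (1 + 1 : Fin 2) = 0 := rfl
    simp only [eq_true h, true_and, if_true]
    generalize x i = a
    generalize x j = b
    generalize y i = c
    generalize y j = d
    fin_cases a <;> fin_cases b <;> fin_cases c <;> fin_cases d <;>
      norm_num [hp0, hp2, Matrix.one_apply, h11]
  · simp [h]

theorem quarterTurn_mem_unitaryGroup (α : Fin 3) :
    ((√2 / 2 : ℝ) : ℂ) • (1 - Complex.I • pauli α) ∈ Matrix.unitaryGroup (Fin 2) ℂ := by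
  have hs : ((√2 / 2 : ℝ) : ℂ) * ((√2 / 2 : ℝ) : ℂ) = 1 / 2 := by
    rw [← Complex.ofReal_mul]
    norm_num [div_mul_div_comm]
  have hstar : star (pauli α) = pauli α := by
    fin_cases α <;> ext a b <;> fin_cases a <;> fin_cases b <;> simp [pauli, Matrix.star_apply]
  rw [Matrix.mem_unitaryGroup_iff, star_smul, star_sub, star_smul, hstar, star_one,
    Complex.star_def, Complex.conj_ofReal, Complex.conj_I, smul_mul_smul_comm,
    hs, neg_smul, sub_neg_eq_add, sub_mul, mul_add, one_mul, one_mul, smul_mul_assoc, mul_add,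
    mul_one, mul_smul_comm, pauli_mul_self, smul_add, smul_smul Complex.I, Complex.I_mul_I]
  module

/-- With `Z` on the control and `X` on the target, CNOT is `exp (i π (1 - Z)(1 - X) / 4)`. Expanding
the exponent into commuting terms gives a phase, two local quarter turns and the entangler. -/
theorem cnot_mem_achievable_of_entangler {i j : Fin n} (hij : i ≠ j) {T : ℝ}
    (h : ((√2 / 2 : ℝ) : ℂ) • (1 + Complex.I • (spin i 2 * spin j 0)) ∈ achievable ω g T) :
    cnot i j ∈ achievable ω g T := by
  have hs : ((√2 / 2 : ℝ) : ℂ) * ((√2 / 2 : ℝ) : ℂ) = 1 / 2 := by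
    rw [← Complex.ofReal_mul]
    norm_num [div_mul_div_comm]
  have h1 := achievable_mul (achievable_mul
    (localOp_mem_achievable (ω := ω) (g := g) i (quarterTurn_mem_unitaryGroup 2))
    (localOp_mem_achievable j (quarterTurn_mem_unitaryGroup 0))) h
  have hphase : ‖((√2 / 2 : ℝ) : ℂ) * (1 + Complex.I)‖ = 1 := by
    have : ‖((√2 / 2 : ℝ) : ℂ) * (1 + Complex.I)‖ ^ 2 = 1 := by
      rw [← Complex.normSq_eq_norm_sq, Complex.normSq_mul, Complex.normSq_ofReal]
      norm_num [Complex.normSq_apply, div_mul_div_comm]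
    nlinarith [norm_nonneg (((√2 / 2 : ℝ) : ℂ) * (1 + Complex.I))]
  have h2 := achievable_smul h1 hphase
  have hQ : ∀ (k : Fin n) (α : Fin 3), localOp k (((√2 / 2 : ℝ) : ℂ) • (1 - Complex.I • pauli α)) =
      ((√2 / 2 : ℝ) : ℂ) • (1 - Complex.I • spin k α) := by
    intro k α
    rw [localOp_smul, sub_eq_add_neg, ← neg_smul, localOp_add, localOp_smul, localOp_one, neg_smul,
      ← sub_eq_add_neg, spin]
  rw [hQ, hQ, add_zero, zero_add] at h2
  convert h2 using 1
  have hZ := spin_mul_self i 2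
  have hX := spin_mul_self j 0
  have hc := (spin_commute hij 2 0).eq
  have e1 : spin i 2 * (spin i 2 * spin j 0) = (spin j 0 : Op n) := by
    rw [← mul_assoc, hZ, one_mul]
  have e2 : spin j 0 * (spin i 2 * spin j 0) = (spin i 2 : Op n) := by
    rw [hc, ← mul_assoc, hX, one_mul]
  have e3 := spin_mul_spin_mul_self hij 2 0
  have hprod : (1 - Complex.I • spin i 2) * (1 - Complex.I • spin j 0) *
      (1 + Complex.I • (spin i 2 * spin j 0)) =
      (1 - Complex.I) • (1 + spin i 2 + spin j 0 - spin i 2 * spin j 0 : Op n) := by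
    have hexpand : (1 - Complex.I • spin i 2) * (1 - Complex.I • spin j 0) =
        (1 - Complex.I • spin i 2 - Complex.I • spin j 0 - spin i 2 * spin j 0 : Op n) := by
      rw [sub_mul, one_mul, mul_sub, mul_one, smul_mul_smul_comm, Complex.I_mul_I]
      module
    rw [hexpand, mul_add, mul_one, mul_smul_comm, sub_mul, sub_mul, sub_mul, one_mul,
      smul_mul_assoc, smul_mul_assoc, e1, e2, e3]
    simp only [smul_sub, smul_smul, Complex.I_mul_I]
    module
  rw [cnot_eq hij, smul_mul_smul_comm, smul_mul_smul_comm, hprod, smul_smul, smul_smul]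
  congr 1
  linear_combination ((√2 / 2 : ℝ) : ℂ) ^ 4 * Complex.I_mul_I -
    2 * (((√2 / 2 : ℝ) : ℂ) ^ 2 + 1 / 2) * hs

theorem cnot_mem_achievable_of_adj {i j : Fin n} (h : (couplingGraph g).Adj i j) :
    cnot i j ∈ achievable ω g (edgeTime g) := by
  refine cnot_mem_achievable_of_entangler h.ne ?_
  rw [couplingGraph, SimpleGraph.fromRel_adj] at h
  obtain ⟨hne, ⟨hlt, α, β, hg⟩ | ⟨hlt, α, β, hg⟩⟩ := h
  · exact entangler_conj_mem_achievable hne (entangler_mem_achievable hlt hg) 2 0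
  · rw [(spin_commute hne 2 0).eq]
    exact entangler_conj_mem_achievable hne.symm (entangler_mem_achievable hlt hg) 0 2

/-! ### CNOT gates between distant qubits, and circuits. -/

/-- The operator that permutes the computational basis by `f`. -/
def basisMap (f : Basis n → Basis n) : Op n := Matrix.of fun x y => if x = f y then 1 else 0

theorem basisMap_mul (f h : Basis n → Basis n) : basisMap f * basisMap h = basisMap (f ∘ h) := by
  ext x y
  simp [basisMap, Matrix.mul_apply]

/-- The two rightmost gates send `(y i, y k)` to `(y i + y k, y i)`, so qubit `k` carries the
control bit when the middle gate acts; the two leftmost gates undo this. Two CNOTs each way suffice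
where a full swap would take three. -/
theorem cnot_eq_conj {i k j : Fin n} (hik : i ≠ k) (hij : i ≠ j) (hkj : k ≠ j) :
    cnot i j = cnot k i * (cnot i k * (cnot k j * (cnot i k * cnot k i))) := by
  have h : ∀ a b : Fin n, cnot a b = basisMap fun y => Function.update y b (y b + y a) :=
    fun _ _ => rfl
  simp only [h, basisMap_mul]
  congr 1
  funext y m
  have h2 : ∀ a b : Fin 2, a = a + b + b := by decide
  have h3 : ∀ a b : Fin 2, a + (b + a) = b := by decide
  by_cases hmj : m = j
  · subst hmj
    simp [hik, hij, hkj, hik.symm, hij.symm, hkj.symm, h3]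
  by_cases hmi : m = i
  · subst hmi
    simp [hik, hij, hkj, hik.symm, hij.symm, hkj.symm, h3]
  by_cases hmk : m = k
  · subst hmk
    simp [hik, hij, hkj, hik.symm, hij.symm, hkj.symm]
    exact h2 _ _
  simp [hmj, hmi, hmk]

theorem edgeTime_nonneg (g : Fin n → Fin n → Fin 3 → Fin 3 → ℝ) : 0 ≤ edgeTime g := by
  have h : 0 ≤ gMin g := by
    refine Real.sInf_nonneg ?_
    rintro r ⟨i, j, α, β, -, -, rfl⟩
    exact abs_nonneg _
  rw [edgeTime]
  have := Real.pi_pos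
  positivity

theorem cnot_mem_achievable_of_walk {i j : Fin n} (p : (couplingGraph g).Walk i j) (hij : i ≠ j) :
    cnot i j ∈ achievable ω g ((4 * (p.length : ℝ) - 3) * edgeTime g) := by
  induction p with
  | nil => exact absurd rfl hij
  | @cons i k j hadj p ih =>
    have hT := edgeTime_nonneg g
    -- If `k = j`, the edge gate already suffices; the rest of the walk may be a closed walk at `j`,
    -- so the bound is only weakened.
    by_cases hkj : k = j
    · subst hkj
      refine achievable_mono ?_ (cnot_mem_achievable_of_adj hadj)
      have : (0 : ℝ) ≤ p.length := by positivity
      rw [SimpleGraph.Walk.length_cons]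
      push_cast
      nlinarith
    · rw [cnot_eq_conj hadj.ne hij hkj]
      have h1 := cnot_mem_achievable_of_adj (ω := ω) hadj
      have h2 := cnot_mem_achievable_of_adj (ω := ω) hadj.symm
      have h := achievable_mul h2 (achievable_mul h1 (achievable_mul (ih hkj)
        (achievable_mul h1 h2)))
      refine achievable_mono (le_of_eq ?_) h
      rw [SimpleGraph.Walk.length_cons]
      push_cast
      ring

theorem cnot_mem_achievable (hconn : (couplingGraph g).Connected) {i j : Fin n} (hij : i ≠ j) :
    cnot i j ∈ achievable ω g ((4 * (n : ℝ) - 7) * edgeTime g) := by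
  classical
  obtain ⟨p, hp⟩ := (hconn.preconnected i j).exists_isPath
  refine achievable_mono ?_ (cnot_mem_achievable_of_walk p hij)
  have hlen : p.length + 1 ≤ n := by simpa using hp.length_lt
  have hlen' : (p.length : ℝ) + 1 ≤ n := by exact_mod_cast hlen
  exact mul_le_mul_of_nonneg_right (by linarith) (edgeTime_nonneg g)

theorem HasCircuit.mem_achievable (hconn : (couplingGraph g).Connected) {k : ℕ} {V : Op n}
    (h : HasCircuit k V) : V ∈ achievable ω g (k * ((4 * (n : ℝ) - 7) * edgeTime g)) := by
  induction h with
  | one => simpa using reachable_subset_achievable 0 (one_mem_reachable le_rfl)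
  | single i A hA _ ih => simpa using achievable_mul (localOp_mem_achievable i hA) ih
  | cnot i j hij _ ih =>
    refine achievable_mono (le_of_eq ?_) (achievable_mul (cnot_mem_achievable hconn hij) ih)
    push_cast
    ring

/-- Membership in `achievable` only gives implementability at times `T + ε`, which is enough for an
infimum. -/
theorem gateTime_le_of_mem_achievable {T : ℝ} {V : Op n} (hT : 0 ≤ T)
    (h : V ∈ achievable ω g T) : gateTime ω g V ≤ ENNReal.ofReal T := by
  refine ENNReal.le_of_forall_pos_le_add fun ε hε _ => ?_
  refine (iInf₂_le (T.toNNReal + ε) (h _ ?_)).trans ?_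
  · rw [NNReal.coe_add, Real.coe_toNNReal T hT]
    have : (0 : ℝ) < ε := hε
    linarith
  · rw [ENNReal.coe_add, ENNReal.ofReal]

end QubitNetwork

theorem mainTheorem3 (n : ℕ) (hn : 2 ≤ n)
    (ω : Fin n → Fin 3 → ℝ) (g : Fin n → Fin n → Fin 3 → Fin 3 → ℝ)
    (hconn : (QubitNetwork.couplingGraph g).Connected)
    (U : QubitNetwork.Op n) (hU : U ∈ Matrix.specialUnitaryGroup (QubitNetwork.Basis n) ℂ) :
    QubitNetwork.gateTime ω g U ≤
      ENNReal.ofReal (Real.pi * (4 * (n : ℝ) - 7) / (4 * QubitNetwork.gMin g)) *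
        (QubitNetwork.cnotCount U : ℝ≥0∞) := by
  have hn' : (2 : ℝ) ≤ n := by exact_mod_cast hn
  have hg : 0 < QubitNetwork.gMin g := by
    have : Nontrivial (Fin n) := Fin.nontrivial_iff_two_le.2 hn
    obtain ⟨j, hj⟩ := hconn.preconnected.exists_adj_of_nontrivial ⟨0, by omega⟩
    rw [QubitNetwork.couplingGraph, SimpleGraph.fromRel_adj] at hj
    obtain ⟨-, ⟨hlt, α, β, h⟩ | ⟨hlt, α, β, h⟩⟩ := hj
    · exact QubitNetwork.gMin_pos hlt h
    · exact QubitNetwork.gMin_pos hlt h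
  have htime : Real.pi * (4 * (n : ℝ) - 7) / (4 * QubitNetwork.gMin g) =
      (4 * (n : ℝ) - 7) * QubitNetwork.edgeTime g := by
    rw [QubitNetwork.edgeTime]; ring
  have hpos : 0 < (4 * (n : ℝ) - 7) * QubitNetwork.edgeTime g := by
    rw [QubitNetwork.edgeTime]
    have := Real.pi_pos
    have : 0 < 4 * (n : ℝ) - 7 := by linarith
    positivity
  rw [htime]
  by_cases hex : ∃ k, QubitNetwork.HasCircuit k U
  · obtain ⟨k, hk, hcount⟩ : ∃ k, QubitNetwork.HasCircuit k U ∧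
        QubitNetwork.cnotCount U = (k : ℕ∞) := by
      classical
      refine ⟨Nat.find hex, Nat.find_spec hex, le_antisymm (iInf₂_le (f := fun (k : ℕ) (_ : QubitNetwork.HasCircuit k U) => (k : ℕ∞))
        (Nat.find hex) (Nat.find_spec hex)) ?_⟩
      exact le_iInf₂ fun k hk => by exact_mod_cast Nat.find_min' hex hk
    rw [hcount]
    refine (QubitNetwork.gateTime_le_of_mem_achievable (by positivity)
      (hk.mem_achievable hconn)).trans_eq ?_
    rw [mul_comm, ENNReal.ofReal_mul hpos.le, ENNReal.ofReal_natCast, ENat.toENNReal_coe]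
  -- Without a circuit the right-hand side is `⊤`, as the time per CNOT is positive; universality of
  -- the gate set is not needed.
  · have hcount : QubitNetwork.cnotCount U = ⊤ := by
      simp only [QubitNetwork.cnotCount, iInf_eq_top]
      exact fun k hk => absurd ⟨k, hk⟩ hex
    rw [hcount, ENat.toENNReal_top, ENNReal.mul_top (by simpa using hpos)]
    exact le_top
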